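/- Let $k$ be a field (of arbitrary characteristic) and let $\Lambda$ be a finite dimensional $k$-algebra of finite global dimension. Let $\hat{\mathcal C}$ be the category whose objects are the complete local commutative Noetherian $k$-algebras $R$ with residue field $k$, and whose morphisms are the continuous $k$-algebra homomorphisms that induce the identity on $k$. For a left $\Lambda$-module $V$ and $R$ in $\hat{\mathcal C}$, a lift of $V$ over $R$ is a pair $(M,\phi)$ of a finitely generated left $R\otimes_k\Lambda$-module $M$ that is free over $R$ and an isomorphism of $\Lambda$-modules $\phi:k\otimes_R M\to V$. Two lifts $(M,\phi)$, $(M',\phi')$ over $R$ are isomorphic if there is an isomorphism $f:M\to M'$ of $R\otimes_k\Lambda$-modules with $\phi'\circ(k\otimes_R f)=\phi$; the isomorphism classes $[M,\phi]$ are the deformations of $V$ over $R$ and form $\mathrm{Def}_\Lambda(V,R)$. A morphism $\alpha:R\to S$ in $\hat{\mathcal C}$ induces the map $\alpha_*:\mathrm{Def}_\Lambda(V,R)\to\mathrm{Def}_\Lambda(V,S)$, $[M,\phi]\mapsto[S\otimes_{R,\alpha}M,\phi_\alpha]$, where $\phi_\alpha$ is the composition $k\otimes_S(S\otimes_{R,\alpha}M)\cong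 k\otimes_R M\xrightarrow{\phi}V$. An object $R$ of $\hat{\mathcal C}$ is a universal deformation ring of $V$ if there is $U\in\mathrm{Def}_\Lambda(V,R)$ such that for every $S$ in $\hat{\mathcal C}$ and every $D\in\mathrm{Def}_\Lambda(V,S)$ there is a unique morphism $\psi:R\to S$ in $\hat{\mathcal C}$ with $\psi_*U=D$. A left $\Lambda$-module $V$ is Gorenstein-projective if there is an acyclic complex $\cdots\to P^{-1}\to P^0\xrightarrow{f^0}P^1\to\cdots$ of (not necessarily finitely generated) projective left $\Lambda$-modules such that $\mathrm{Hom}_\Lambda(P^\bullet,\Lambda)$ is also acyclic and $V\cong\mathrm{coker}\,f^0$. Then every finitely generated Gorenstein-projective left $\Lambda$-module $V$ has a universal deformation ring, and this ring is isomorphic to $k$ in $\hat{\mathcal C}$. -/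

import Mathlib

open CategoryTheory TensorProduct

universe u

noncomputable section

namespace ModuleDeformation

/-! ### Homological notions for left modules over a ring -/

section Homological

variable (Λ : Type u) [Ring Λ]

/-- The (left) global dimension of `Λ`: the supremum of the projective dimensions of all left
`Λ`-modules. -/
def globalDimension : WithBot ℕ∞ :=
  ⨆ M : ModuleCat.{u} Λ, projectiveDimension M

/-- `M` is Gorenstein-projective: there is an acyclic complex
`⋯ → P (-1) → P 0 → P 1 → P 2 → ⋯` of (not necessarily finitely generated) projective left
`Λ`-modules such that `Hom_Λ(P, Λ)` is acyclic as well and `M` is isomorphic to the cokernel of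
`f 0 : P 0 → P 1`. -/
def IsGorensteinProjective (M : Type u) [AddCommGroup M] [Module Λ M] : Prop :=
  ∃ (P : ℤ → ModuleCat.{u} Λ) (f : ∀ i : ℤ, P i →ₗ[Λ] P (i + 1)),
    (∀ i, Module.Projective Λ (P i)) ∧
    (∀ i, Function.Exact (f i) (f (i + 1))) ∧
    (∀ i, Function.Exact
      (fun h : P (i + 1 + 1) →ₗ[Λ] Λ => h.comp (f (i + 1)))
      (fun g : P (i + 1) →ₗ[Λ] Λ => g.comp (f i))) ∧
    Nonempty (M ≃ₗ[Λ] (P (0 + 1) ⧸ LinearMap.range (f 0)))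

end Homological

/-! ### The category of complete local commutative Noetherian `k`-algebras with residue field `k` -/

/-- A complete local commutative Noetherian `k`-algebra with residue field `k`. -/
structure CompleteLocalAlg (k : Type u) [Field k] where
  carrier : Type u
  [commRing : CommRing carrier]
  [algebra : Algebra k carrier]
  [isLocalRing : IsLocalRing carrier]
  [isNoetherianRing : IsNoetherianRing carrier]
  [isAdicComplete : IsAdicComplete (IsLocalRing.maximalIdeal carrier) carrier]
  bijective_residue : Function.Bijective (algebraMap k (IsLocalRing.ResidueField carrier))

namespace CompleteLocalAlg

variable {k : Type u} [Field k]

instance : CoeSort (CompleteLocalAlg k) (Type u) := ⟨carrier⟩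

attribute [instance] commRing algebra isLocalRing isNoetherianRing isAdicComplete

/-- The canonical surjection `R → k` onto the residue field of `R`, identified with `k`
through the structure map. -/
def residueMap (R : CompleteLocalAlg k) : R →ₐ[k] k :=
  (AlgEquiv.ofBijective (Algebra.ofId k (IsLocalRing.ResidueField R))
    R.bijective_residue).symm.toAlgHom.comp
    (IsScalarTower.toAlgHom k R (IsLocalRing.ResidueField R))

/-- Morphisms: continuous (for the topologies defined by the maximal ideals) homomorphisms of
`k`-algebras which induce the identity on the residue fields `k`. -/
@[ext]
structure Hom (R S : CompleteLocalAlg k) where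
  toAlgHom : R →ₐ[k] S
  continuous : @Continuous R S (IsLocalRing.maximalIdeal R).adicTopology
    (IsLocalRing.maximalIdeal S).adicTopology toAlgHom
  residue_comp : S.residueMap.comp toAlgHom = R.residueMap

instance : Category (CompleteLocalAlg k) where
  Hom R S := Hom R S
  id R := ⟨AlgHom.id k R, @continuous_id R (IsLocalRing.maximalIdeal R).adicTopology, rfl⟩
  comp {R S T} f g := ⟨g.toAlgHom.comp f.toAlgHom,
    @Continuous.comp R S T (IsLocalRing.maximalIdeal R).adicTopology
      (IsLocalRing.maximalIdeal S).adicTopology (IsLocalRing.maximalIdeal T).adicTopology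
      _ _ g.continuous f.continuous, by
    rw [← AlgHom.comp_assoc, g.residue_comp, f.residue_comp]⟩

lemma residueMap_comp {R S : CompleteLocalAlg k} (α : R ⟶ S) :
    (S.residueMap : S →+* k).comp (α.toAlgHom : R →+* S) = (R.residueMap : R →+* k) := by
  rw [← α.residue_comp]; rfl

variable (k) in
/-- The field `k` as an object of the category. -/
def base : CompleteLocalAlg k :=
  haveI : IsAdicComplete (IsLocalRing.maximalIdeal k) k := by
    rw [IsLocalRing.maximalIdeal_eq_bot]; infer_instance
  { carrier := k
    bijective_residue := ⟨(algebraMap k (IsLocalRing.ResidueField k)).injective,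
      IsLocalRing.residue_surjective⟩ }

end CompleteLocalAlg

/-! ### Extension of scalars for modules with an additional commuting action -/

section BaseChange

variable {R A B : Type u} [CommRing R] [CommRing A] [CommRing B]

/-- `A ⊗_{R, f} M`, for a ring homomorphism `f : R → A` and an `R`-module `M`. -/
def BaseChange (f : R →+* A) (M : Type u) [AddCommGroup M] [Module R M] : Type u :=
  letI := f.toAlgebra
  A ⊗[R] M

namespace BaseChange

variable (f : R →+* A) (M : Type u) [AddCommGroup M] [Module R M]

instance : AddCommGroup (BaseChange f M) :=
  letI := f.toAlgebra
  (inferInstance : AddCommGroup (A ⊗[R] M))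

instance : Module A (BaseChange f M) :=
  letI := f.toAlgebra
  (inferInstance : Module A (A ⊗[R] M))

variable {M} in
/-- The pure tensor `a ⊗ m`. -/
def tmul (a : A) (m : M) : BaseChange f M :=
  letI := f.toAlgebra
  a ⊗ₜ[R] m

variable {f M}

lemma induction {p : BaseChange f M → Prop} (x : BaseChange f M) (h0 : p 0)
    (ht : ∀ a m, p (tmul f a m)) (ha : ∀ x y, p x → p y → p (x + y)) : p x :=
  letI := f.toAlgebra
  TensorProduct.induction_on (R := R) (M := A) (N := M) x h0 ht ha

lemma smul_tmul (a b : A) (m : M) : a • tmul f b m = tmul f (a * b) m := rfl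

lemma tmul_smul (r : R) (a : A) (m : M) : tmul f a (r • m) = tmul f (f r * a) m :=
  letI := f.toAlgebra
  (TensorProduct.smul_tmul r a m).symm

lemma tmul_add (a : A) (m n : M) : tmul f a (m + n) = tmul f a m + tmul f a n :=
  letI := f.toAlgebra
  TensorProduct.tmul_add a m n

lemma tmul_zero (a : A) : tmul f a (0 : M) = 0 :=
  letI := f.toAlgebra
  TensorProduct.tmul_zero M a

/-- The map `A ⊗ g : A ⊗_R M → A ⊗_R N` induced by an `R`-linear map `g`. -/
def map (f : R →+* A) {N : Type u} [AddCommGroup N] [Module R N] (g : M →ₗ[R] N) :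
    BaseChange f M →ₗ[A] BaseChange f N :=
  letI := f.toAlgebra
  g.baseChange A

@[simp]
lemma map_tmul {N : Type u} [AddCommGroup N] [Module R N] (g : M →ₗ[R] N) (a : A) (m : M) :
    map f g (tmul f a m) = tmul f a (g m) := rfl

variable (M) in
/-- The canonical isomorphism `B ⊗_A (A ⊗_R M) ≅ B ⊗_R M`, `b ⊗ (a ⊗ m) ↦ (b * g a) ⊗ m`, where
`h : R → B` is the composition of `f : R → A` and `g : A → B`. -/
def cancelLinear (f : R →+* A) (g : A →+* B) (h : R →+* B) (hgf : g.comp f = h) :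
    BaseChange g (BaseChange f M) ≃ₗ[B] BaseChange h M :=
  letI := f.toAlgebra
  letI := g.toAlgebra
  letI := h.toAlgebra
  haveI : IsScalarTower R A B := IsScalarTower.of_algebraMap_eq' hgf.symm
  AlgebraTensorModule.cancelBaseChange R A B B M

lemma cancelLinear_tmul (f : R →+* A) (g : A →+* B) (h : R →+* B) (hgf : g.comp f = h)
    (b : B) (a : A) (m : M) :
    cancelLinear M f g h hgf (tmul g b (tmul f a m)) = tmul h (b * g a) m := by
  let _ := f.toAlgebra
  let _ := g.toAlgebra
  let _ := h.toAlgebra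
  have : IsScalarTower R A B := IsScalarTower.of_algebraMap_eq' hgf.symm
  change (a • b) ⊗ₜ[R] m = (b * g a) ⊗ₜ[R] m
  rw [Algebra.smul_def, mul_comm]; rfl

/-- The isomorphism `A ⊗ e : A ⊗_R M ≅ A ⊗_R N` induced by an `R`-linear isomorphism `e`. -/
def mapEquiv (f : R →+* A) {N : Type u} [AddCommGroup N] [Module R N] (e : M ≃ₗ[R] N) :
    BaseChange f M ≃ₗ[A] BaseChange f N :=
  { map f e.toLinearMap with
    invFun := map f e.symm.toLinearMap
    left_inv := fun x => by
      change map f e.symm.toLinearMap (map f e.toLinearMap x) = x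
      induction x using induction with
      | h0 => simp
      | ht a m => simp
      | ha x y hx hy => simp only [map_add, hx, hy]
    right_inv := fun x => by
      change map f e.toLinearMap (map f e.symm.toLinearMap x) = x
      induction x using induction with
      | h0 => simp
      | ht a m => simp
      | ha x y hx hy => simp only [map_add, hx, hy] }

lemma cancelLinear_map (f : R →+* A) (g : A →+* B) (h : R →+* B) (hgf : g.comp f = h)
    {N : Type u} [AddCommGroup N] [Module R N] (e : M →ₗ[R] N) (x : BaseChange g (BaseChange f M)) :
    cancelLinear N f g h hgf (map g (map f e) x) = map h e (cancelLinear M f g h hgf x) := by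
  induction x using induction with
  | h0 => simp
  | ht b y =>
    induction y using BaseChange.induction with
    | h0 => simp [tmul_zero]
    | ht a m => simp only [map_tmul, cancelLinear_tmul]
    | ha y z hy hz => simp only [tmul_add, map_add, hy, hz]
  | ha x y hx hy => simp only [map_add, hx, hy]

section Action

variable {Λ : Type u} [Ring Λ] [Module Λ M] [SMulCommClass R Λ M]

/-- The endomorphism of an `R`-module given by an element of a ring which acts `R`-linearly. -/
def actionEnd (R : Type u) [CommRing R] {Λ : Type u} [Ring Λ] (M : Type u) [AddCommGroup M]
    [Module R M] [Module Λ M] [SMulCommClass R Λ M] (l : Λ) : M →ₗ[R] M where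
  toFun m := l • m
  map_add' := smul_add l
  map_smul' r m := (smul_comm r l m).symm

/-- `Λ` acts on `A ⊗_R M` through the second factor: `l • (a ⊗ m) = a ⊗ (l • m)`. -/
instance : Module Λ (BaseChange f M) where
  smul l x := map f (actionEnd R M l) x
  one_smul x := by
    change map f (actionEnd R M (1 : Λ)) x = x
    induction x using induction with
    | h0 => simp
    | ht a m => simp [actionEnd]
    | ha x y hx hy => simp [hx, hy]
  mul_smul l l' x := by
    change map f (actionEnd R M (l * l')) x
      = map f (actionEnd R M l) (map f (actionEnd R M l') x)
    induction x using induction with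
    | h0 => simp
    | ht a m => simp [actionEnd, mul_smul]
    | ha x y hx hy => simp [hx, hy]
  smul_zero l := map_zero (map f (actionEnd R M l))
  smul_add l := map_add (map f (actionEnd R M l))
  add_smul l l' x := by
    change map f (actionEnd R M (l + l')) x
      = map f (actionEnd R M l) x + map f (actionEnd R M l') x
    induction x using induction with
    | h0 => simp
    | ht a m => simp [actionEnd, add_smul, tmul_add]
    | ha x y hx hy => simp only [map_add, hx, hy]; abel
  zero_smul x := by
    change map f (actionEnd R M (0 : Λ)) x = 0
    induction x using induction with
    | h0 => simp
    | ht a m => simp [actionEnd, tmul_zero]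
    | ha x y hx hy => simp [hx, hy]

lemma act_tmul (l : Λ) (a : A) (m : M) : l • tmul f a m = tmul f a (l • m) := rfl

instance : SMulCommClass A Λ (BaseChange f M) where
  smul_comm a l x := (map_smul (map f (actionEnd R M l)) a x).symm

/-- For a map `g` which is `R`-linear and `Λ`-linear, so is `A ⊗ g`. -/
lemma map_act {N : Type u} [AddCommGroup N] [Module R N] [Module Λ N] [SMulCommClass R Λ N]
    (g : M →ₗ[R] N) (hg : ∀ (l : Λ) m, g (l • m) = l • g m) (l : Λ) (x : BaseChange f M) :
    map f g (l • x) = l • map f g x := by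
  induction x using induction with
  | h0 => simp
  | ht a m => simp [act_tmul, hg]
  | ha x y hx hy => simp [hx, hy]

/-- The canonical isomorphism `cancelLinear` as an isomorphism of `Λ`-modules. -/
def cancel (Λ : Type u) [Ring Λ] (M : Type u) [AddCommGroup M] [Module R M] [Module Λ M]
    [SMulCommClass R Λ M] (f : R →+* A) (g : A →+* B) (h : R →+* B) (hgf : g.comp f = h) :
    BaseChange g (BaseChange f M) ≃ₗ[Λ] BaseChange h M :=
  { (cancelLinear M f g h hgf).toAddEquiv with
    map_smul' := fun l x => by
      change cancelLinear M f g h hgf (l • x) = l • cancelLinear M f g h hgf x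
      induction x using BaseChange.induction with
      | h0 => simp
      | ht b y =>
        rw [act_tmul]
        induction y using BaseChange.induction with
        | h0 => simp [tmul_zero]
        | ht a m => simp only [act_tmul, cancelLinear_tmul]
        | ha y z hy hz => simp only [smul_add, tmul_add, map_add, hy, hz]
      | ha x y hx hy => simp only [smul_add, map_add, hx, hy] }

lemma cancel_tmul (f : R →+* A) (g : A →+* B) (h : R →+* B) (hgf : g.comp f = h)
    (b : B) (a : A) (m : M) :
    cancel Λ M f g h hgf (tmul g b (tmul f a m)) = tmul h (b * g a) m :=
  cancelLinear_tmul f g h hgf b a m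

end Action

end BaseChange

end BaseChange
/-! ### Lifts, deformations and universal deformation rings -/

section Deformation

variable {k : Type u} [Field k] (Λ : Type u) [Ring Λ] [Algebra k Λ]
  (V : Type u) [AddCommGroup V] [Module Λ V]

/-- A lift `(M, φ)` of the `Λ`-module `V` over `R`: a finitely generated left
`R ⊗_k Λ`-module `M` which is free over `R`, with an isomorphism of `Λ`-modules
`φ : k ⊗_R M ≅ V`.
A left `R ⊗_k Λ`-module is given as an abelian group with commuting actions of `R` and of `Λ` which
restrict to the same action of `k`; the action of `R ⊗_k Λ` is `(r ⊗ l) • m = r • l • m`. -/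
structure Lift (R : CompleteLocalAlg k) where
  M : Type u
  [addCommGroup : AddCommGroup M]
  [moduleBase : Module k M]
  [moduleRing : Module R M]
  [moduleAlg : Module Λ M]
  [towerRing : IsScalarTower k R M]
  [towerAlg : IsScalarTower k Λ M]
  [smulComm : SMulCommClass R Λ M]
  finite : letI : Module (R ⊗[k] Λ) M := TensorProduct.Algebra.module
    Module.Finite (R ⊗[k] Λ) M
  free : Module.Free R M
  φ : BaseChange (R.residueMap : R →+* k) M ≃ₗ[Λ] V

namespace Lift

attribute [instance] addCommGroup moduleBase moduleRing moduleAlg towerRing towerAlg smulComm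

variable {Λ V} {R S : CompleteLocalAlg k}

/-- Two lifts `(M, φ)` and `(M', φ')` over `R` are isomorphic if there is an isomorphism
`f : M ≅ M'` of `R ⊗_k Λ`-modules (that is, `R`-linear and `Λ`-linear) such that
`φ' ∘ (k ⊗_R f) = φ`. -/
def Iso (L L' : Lift Λ V R) : Prop :=
  ∃ f : L.M ≃ₗ[R] L'.M, (∀ (l : Λ) (m : L.M), f (l • m) = l • f m) ∧
    ∀ x, L'.φ (BaseChange.map _ f.toLinearMap x) = L.φ x

lemma Iso.refl (L : Lift Λ V R) : Iso L L := by
  refine ⟨LinearEquiv.refl R L.M, fun _ _ => rfl, fun x => congrArg L.φ ?_⟩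
  induction x using BaseChange.induction with
  | h0 => simp
  | ht a m => rfl
  | ha x y hx hy => simp only [map_add, hx, hy]

lemma Iso.trans {L L' L'' : Lift Λ V R} : Iso L L' → Iso L' L'' → Iso L L'' := by
  rintro ⟨f, hf, hf'⟩ ⟨g, hg, hg'⟩
  refine ⟨f.trans g, fun l m => by simp [hf, hg], fun x => ?_⟩
  rw [← hf' x, ← hg']
  congr 1
  induction x using BaseChange.induction with
  | h0 => simp
  | ht a m => rfl
  | ha x y hx hy => simp only [map_add, hx, hy]

lemma Iso.symm {L L' : Lift Λ V R} : Iso L L' → Iso L' L := by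
  rintro ⟨f, hf, hf'⟩
  refine ⟨f.symm, fun l m => ?_, fun x => ?_⟩
  · apply f.injective
    rw [hf]; simp
  · rw [← hf']
    congr 1
    induction x using BaseChange.induction with
    | h0 => simp
    | ht a m => simp
    | ha x y hx hy => simp only [map_add, hx, hy]

variable (Λ V R) in
instance setoid : Setoid (Lift Λ V R) := ⟨Iso, Iso.refl, Iso.symm, Iso.trans⟩

lemma finite_over_ring [Module.Finite k Λ] (L : Lift Λ V R) : Module.Finite R L.M := by
  let _ : Module (R ⊗[k] Λ) L.M := TensorProduct.Algebra.module
  have := L.finite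
  have : IsScalarTower R (R ⊗[k] Λ) L.M := by
    refine IsScalarTower.of_algebraMap_smul fun r m => ?_
    rw [Algebra.TensorProduct.algebraMap_apply, TensorProduct.Algebra.smul_def]
    simp
  exact Module.Finite.trans (R ⊗[k] Λ) L.M

/-- For a morphism `α : R → S` and a lift `(M, φ)` over `R`, the lift `(S ⊗_{R, α} M, φ_α)` over
`S`, where `φ_α` is the composition `k ⊗_S (S ⊗_{R, α} M) ≅ k ⊗_R M ≅ V`. -/
def baseChange [Module.Finite k Λ] (α : R ⟶ S) (L : Lift Λ V R) : Lift Λ V S :=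
  letI : Module k (BaseChange (α.toAlgHom : R →+* S) L.M) := Module.compHom _ (algebraMap k S)
  haveI : IsScalarTower k S (BaseChange (α.toAlgHom : R →+* S) L.M) :=
    IsScalarTower.of_algebraMap_smul fun _ _ => rfl
  haveI : IsScalarTower k Λ (BaseChange (α.toAlgHom : R →+* S) L.M) := by
    refine IsScalarTower.of_algebraMap_smul fun c x => ?_
    change _ = algebraMap k S c • x
    induction x using BaseChange.induction with
    | h0 => simp
    | ht a m =>
      rw [BaseChange.act_tmul, algebraMap_smul, BaseChange.smul_tmul,
        ← algebraMap_smul (R := k) R c m, BaseChange.tmul_smul]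
      simp
    | ha x y hx hy => simp only [smul_add, hx, hy]
  { M := BaseChange (α.toAlgHom : R →+* S) L.M
    finite := by
      let _ : Module (S ⊗[k] Λ) (BaseChange (α.toAlgHom : R →+* S) L.M) :=
        TensorProduct.Algebra.module
      have : IsScalarTower S (S ⊗[k] Λ) (BaseChange (α.toAlgHom : R →+* S) L.M) := by
        refine IsScalarTower.of_algebraMap_smul fun r m => ?_
        rw [Algebra.TensorProduct.algebraMap_apply, TensorProduct.Algebra.smul_def]
        simp
      have : Module.Finite S (BaseChange (α.toAlgHom : R →+* S) L.M) := by
        have := L.finite_over_ring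
        let _ := (α.toAlgHom : R →+* S).toAlgebra
        exact (inferInstance : Module.Finite S (S ⊗[R] L.M))
      exact Module.Finite.of_restrictScalars_finite S (S ⊗[k] Λ) _
    free := by
      have := L.free
      let _ := (α.toAlgHom : R →+* S).toAlgebra
      exact (inferInstance : Module.Free S (S ⊗[R] L.M))
    φ := (BaseChange.cancel Λ L.M (α.toAlgHom : R →+* S) (S.residueMap : S →+* k)
        (R.residueMap : R →+* k) (CompleteLocalAlg.residueMap_comp α)).trans L.φ }

lemma baseChange_iso [Module.Finite k Λ] (α : R ⟶ S) {L L' : Lift Λ V R} (h : L ≈ L') :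
    baseChange α L ≈ baseChange α L' := by
  obtain ⟨f, hf, hf'⟩ := h
  exact ⟨BaseChange.mapEquiv (α.toAlgHom : R →+* S) f, BaseChange.map_act f.toLinearMap hf,
    fun x => (congrArg L'.φ (BaseChange.cancelLinear_map (α.toAlgHom : R →+* S)
      (S.residueMap : S →+* k) (R.residueMap : R →+* k)
      (CompleteLocalAlg.residueMap_comp α) f.toLinearMap x)).trans (hf' _)⟩

end Lift

/-- The set `Def_Λ(V, R)` of deformations of `V` over `R`, i.e. of isomorphism classes of lifts. -/
def Deformation (R : CompleteLocalAlg k) : Type (u + 1) := Quotient (Lift.setoid Λ V R)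

variable {Λ V} in
/-- The map `Def_Λ(V, R) → Def_Λ(V, S)`, `[M, φ] ↦ [S ⊗_{R, α} M, φ_α]`, which the deformation
functor assigns to a morphism `α : R → S`. -/
def Deformation.map [Module.Finite k Λ] {R S : CompleteLocalAlg k} (α : R ⟶ S) :
    Deformation Λ V R → Deformation Λ V S :=
  Quotient.map (Lift.baseChange α) fun _ _ h => Lift.baseChange_iso α h

/-- `R` is a universal deformation ring of `V`: there is a deformation `U` of `V` over `R` such that
every deformation of `V` over any `S` is the image of `U` under a unique morphism `R → S`. -/
def IsUniversalDeformationRing [Module.Finite k Λ] (R : CompleteLocalAlg k) : Prop :=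
  ∃ U : Deformation Λ V R, ∀ (S : CompleteLocalAlg k) (D : Deformation Λ V S),
    ∃! ψ : R ⟶ S, Deformation.map ψ U = D

end Deformation

end ModuleDeformation

end

/-! Finite global dimension forces `V` to be projective. As a cokernel in an acyclic complex of
projectives that continues indefinitely to the right, `V` is an `n`-th syzygy for every `n`, and
`n`-th syzygies are projective once `n` reaches the global dimension
(`IsGorensteinProjective.projective`).

A projective `V` has only trivial deformations. For a lift `M` over `S`, the reduction `M → V` has a
`Λ`-linear section, which extends to an `S`-linear and `Λ`-linear map `S ⊗ V → M` compatible with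
the reductions. It is surjective by Nakayama, and bijective because both sides are free over `S` of
rank `dim V` (`Lift.iso_of_map`). Hence every lift is induced from `k`
(`Lift.baseChange_base_equiv`), and `k` is initial in the category, so the morphism inducing it is
unique. -/

noncomputable section

namespace ModuleDeformation

/-! ### Gorenstein-projective modules over rings of finite global dimension -/

section Homological

variable {Λ : Type u} [Ring Λ]

lemma exists_hasProjectiveDimensionLT (h : globalDimension Λ < ⊤) :
    ∃ n : ℕ, ∀ M : ModuleCat.{u} Λ, HasProjectiveDimensionLT M (n + 1) := by
  obtain ⟨n, hn⟩ : ∃ n : ℕ, globalDimension Λ ≤ n := by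
    generalize globalDimension Λ = d at h
    induction d with
    | bot => exact ⟨0, bot_le⟩
    | coe d =>
      induction d with
      | top => exact absurd h (lt_irrefl _)
      | coe n => exact ⟨n, le_rfl⟩
  exact ⟨n, fun M => (projectiveDimension_le_iff M n).1 ((le_iSup _ M).trans hn)⟩

/-- In an exact sequence of projective modules, if the projective dimensions of the cokernels are
bounded then the cokernels are projective. -/
lemma projective_coker_of_exact (P : ℤ → ModuleCat.{u} Λ) (f : ∀ i : ℤ, P i →ₗ[Λ] P (i + 1))
    (hP : ∀ i, Module.Projective Λ (P i)) (hf : ∀ i, Function.Exact (f i) (f (i + 1))) (n : ℕ)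
    (hn : ∀ i, HasProjectiveDimensionLT
      (ModuleCat.of Λ (P (i + 1) ⧸ LinearMap.range (f i))) (n + 1)) (i : ℤ) :
    Module.Projective Λ (P (i + 1) ⧸ LinearMap.range (f i)) := by
  induction n generalizing i with
  | zero =>
    have := projective_iff_hasProjectiveDimensionLT_one.2 (hn i)
    exact (IsProjective.iff_projective _).2 this
  | succ n ih =>
    -- Write `C i` for the cokernel of `f i`. The sequence `0 → C i → P (i + 2) → C (i + 1) → 0` is
    -- exact with projective middle term, so the bound at `i + 1` yields a bound smaller by one at
    -- `i`. The bound thus drops for all `i` at once.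
    refine ih (fun i => ?_) i
    have hle : LinearMap.range (f i) ≤ LinearMap.ker (f (i + 1)) :=
      ((LinearMap.exact_iff).1 (hf i)).ge
    let g : (P (i + 1) ⧸ LinearMap.range (f i)) →ₗ[Λ] P (i + 1 + 1) :=
      (LinearMap.range (f i)).liftQ (f (i + 1)) hle
    have hg : Function.Injective g :=
      LinearMap.ker_eq_bot.1 (Submodule.ker_liftQ_eq_bot _ _ _ ((LinearMap.exact_iff).1 (hf i)).le)
    let q : P (i + 1 + 1) →ₗ[Λ] (P (i + 1 + 1) ⧸ LinearMap.range (f (i + 1))) :=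
      (LinearMap.range (f (i + 1))).mkQ
    have hgq : Function.Exact g q := by
      rw [LinearMap.exact_iff, Submodule.ker_mkQ, Submodule.range_liftQ]
    let S : ShortComplex (ModuleCat.{u} Λ) :=
      ShortComplex.mk (ModuleCat.ofHom g) (ModuleCat.ofHom q) (by
        refine ModuleCat.hom_ext (LinearMap.ext fun x => ?_)
        exact hgq.apply_apply_eq_zero x)
    have hS : S.ShortExact :=
      { exact := (ShortComplex.ShortExact.moduleCat_exact_iff_function_exact S).2 hgq
        mono_f := (ModuleCat.mono_iff_injective _).2 hg
        epi_g := (ModuleCat.epi_iff_surjective _).2 (Submodule.mkQ_surjective _) }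
    have : Projective S.X₂ := (IsProjective.iff_projective _).1 (hP (i + 1 + 1))
    exact hS.hasProjectiveDimensionLT_X₁ (n + 1)
      (hasProjectiveDimensionLT_of_ge _ 1 _ (by omega)) (hn (i + 1))

lemma IsGorensteinProjective.projective (h : globalDimension Λ < ⊤) {V : Type u} [AddCommGroup V]
    [Module Λ V] (hV : IsGorensteinProjective Λ V) : Module.Projective Λ V := by
  obtain ⟨P, f, hP, hf, -, ⟨e⟩⟩ := hV
  obtain ⟨n, hn⟩ := exists_hasProjectiveDimensionLT h
  have := projective_coker_of_exact P f hP hf n (fun i => hn _) 0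
  exact Module.Projective.of_equiv e.symm

end Homological

/-! ### Elements and ranks of base changes -/

namespace BaseChange

variable {R A : Type u} [CommRing R] [CommRing A] (f : R →+* A)
  {M : Type u} [AddCommGroup M] [Module R M]

/-- The `A`-linear map `A ⊗_R M → N` given by a map `M → N` which is linear along `R → A`. -/
def lift {N : Type u} [AddCommGroup N] [Module A N] (g : M →ₛₗ[f] N) : BaseChange f M →ₗ[A] N :=
  letI := f.toAlgebra
  letI : Module R N := Module.compHom N f
  haveI : IsScalarTower R A N := IsScalarTower.of_algebraMap_smul fun _ _ => rfl
  LinearMap.liftBaseChange A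
    ({ toFun := g, map_add' := map_add g, map_smul' := fun r m => map_smulₛₗ g r m } : M →ₗ[R] N)

lemma lift_tmul {N : Type u} [AddCommGroup N] [Module A N] (g : M →ₛₗ[f] N) (a : A) (m : M) :
    lift f g (tmul f a m) = a • g m := by
  let _ := f.toAlgebra
  let _ : Module R N := Module.compHom N f
  have : IsScalarTower R A N := IsScalarTower.of_algebraMap_smul fun _ _ => rfl
  exact LinearMap.liftBaseChange_tmul ..

/-- Scalars of `A` come from `R` and can be moved to the right factor. With `f` the residue map,
this replaces induction on tensors by a choice of representative in `M`. -/
lemma exists_tmul_one_eq (hf : Function.Surjective f) (x : BaseChange f M) :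
    ∃ m : M, tmul f 1 m = x := by
  induction x using induction with
  | h0 => exact ⟨0, tmul_zero 1⟩
  | ht a m =>
    obtain ⟨r, rfl⟩ := hf a
    exact ⟨r • m, by rw [tmul_smul, mul_one]⟩
  | ha x y hx hy =>
    obtain ⟨m, rfl⟩ := hx
    obtain ⟨n, rfl⟩ := hy
    exact ⟨m + n, tmul_add 1 m n⟩

lemma tmul_one_injective (hf : Function.Bijective f) :
    Function.Injective (tmul f 1 : M → BaseChange f M) := by
  let _ := f.toAlgebra
  let e : R ≃ₗ[R] A := LinearEquiv.ofBijective (Algebra.linearMap R A) hf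
  intro m n h
  have h' : (1 : A) ⊗ₜ[R] m = 1 ⊗ₜ[R] n := h
  have he : e 1 = 1 := map_one f
  rw [← he, ← LinearEquiv.rTensor_tmul, ← LinearEquiv.rTensor_tmul] at h'
  have := (LinearEquiv.rTensor M e).injective h'
  simpa using congrArg (TensorProduct.lid R M) this

/-- The `Λ`-linear map `M → A ⊗_R M`, `m ↦ 1 ⊗ m`. -/
def mk (Λ : Type u) [Ring Λ] [Module Λ M] [SMulCommClass R Λ M] : M →ₗ[Λ] BaseChange f M where
  toFun m := tmul f 1 m
  map_add' := tmul_add 1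
  map_smul' l m := (act_tmul l 1 m).symm

lemma finrank_eq [StrongRankCondition R] [StrongRankCondition A] [Module.Free R M] :
    Module.finrank A (BaseChange f M) = Module.finrank R M :=
  letI := f.toAlgebra
  Module.finrank_baseChange

end BaseChange

/-! ### Residue maps, Nakayama's lemma, and `k` as initial object -/

namespace CompleteLocalAlg

variable {k : Type u} [Field k]

lemma residueMap_algebraMap (S : CompleteLocalAlg k) (c : k) :
    (S.residueMap : S →+* k) (algebraMap k S c) = c :=
  S.residueMap.commutes c

lemma residueMap_surjective (S : CompleteLocalAlg k) :
    Function.Surjective (S.residueMap : S →+* k) :=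
  fun c => ⟨_, S.residueMap_algebraMap c⟩

lemma residueMap_base_bijective :
    Function.Bijective ((base k).residueMap : base k →+* k) := by
  refine ⟨fun a b h => ?_, (base k).residueMap_surjective⟩
  -- The structure map `k → base k` is definitionally the identity, so the residue map fixes every
  -- element.
  exact ((base k).residueMap_algebraMap a).symm.trans (h.trans ((base k).residueMap_algebraMap b))

/-- Nakayama's lemma for the residue field `k` of `S`. -/
lemma eq_top_of_tmul (S : CompleteLocalAlg k) {M : Type u} [AddCommGroup M] [Module S M]
    [Module.Finite S M] (N : Submodule S M)
    (h : ∀ m, ∃ n ∈ N, BaseChange.tmul (S.residueMap : S →+* k) 1 m =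
      BaseChange.tmul (S.residueMap : S →+* k) 1 n) : N = ⊤ := by
  rw [← IsLocalRing.map_tensorProduct_mk_eq_top, eq_top_iff]
  rintro x -
  obtain ⟨m, rfl⟩ := TensorProduct.mk_surjective S M (IsLocalRing.ResidueField S)
    IsLocalRing.residue_surjective x
  obtain ⟨n, hn, hmn⟩ := h m
  refine ⟨n, hn, ?_⟩
  let _ := (S.residueMap : S →+* k).toAlgebra
  let e := AlgEquiv.ofBijective (Algebra.ofId k (IsLocalRing.ResidueField S)) S.bijective_residue
  -- The Nakayama criterion tensors with the residue field, whereas `h` is about `k`. The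
  -- isomorphism `e` is `S`-linear because `residueMap` is the residue followed by the inverse of
  -- `e`.
  let e' : k →ₗ[S] IsLocalRing.ResidueField S :=
    { toFun := e
      map_add' := map_add e
      map_smul' := fun s c => by
        change e (S.residueMap s * c) = _
        rw [map_mul, Algebra.smul_def]
        congr 1
        exact e.apply_symm_apply _ }
  have key := congrArg (e'.rTensor M) (show (1 : k) ⊗ₜ[S] m = 1 ⊗ₜ[S] n from hmn)
  have h1 : e' 1 = 1 := map_one e
  rw [LinearMap.rTensor_tmul, LinearMap.rTensor_tmul, h1] at key
  exact key.symm

/-- The structure map of `S`, as a morphism from `k`. -/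
def fromBase (S : CompleteLocalAlg k) : base k ⟶ S where
  toAlgHom := Algebra.ofId k S
  continuous := by
    let _ := (IsLocalRing.maximalIdeal (base k)).adicTopology
    let _ := (IsLocalRing.maximalIdeal S).adicTopology
    have h : IsAdic (IsLocalRing.maximalIdeal (base k)) := rfl
    -- The topology defined by the zero ideal is discrete, so continuity is automatic.
    have hb : IsLocalRing.maximalIdeal (base k) = ⊥ := IsLocalRing.maximalIdeal_eq_bot (R := k)
    rw [hb] at h
    have : DiscreteTopology (base k) := is_bot_adic_iff.1 h
    exact continuous_of_discreteTopology
  residue_comp := AlgHom.ext fun c =>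
    (S.residueMap.commutes c).trans ((base k).residueMap.commutes c).symm

lemma fromBase_unique {S : CompleteLocalAlg k} (α β : base k ⟶ S) : α = β := by
  apply Hom.ext
  refine AlgHom.ext fun c => ?_
  exact (α.toAlgHom.commutes c).trans (β.toAlgHom.commutes c).symm

end CompleteLocalAlg

/-! ### Triviality of the deformations of a projective module -/

section Deformation

open CompleteLocalAlg

variable {k Λ V : Type u} [Field k] [Ring Λ] [Algebra k Λ] [AddCommGroup V] [Module Λ V]

variable (k Λ V) in
/-- The tautological lift of `V` over `k`. -/
def trivialLift [Module.Finite k Λ] [Module.Finite Λ V] : Lift Λ V (base k) :=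
  letI m : Module k V := Module.compHom V (algebraMap k Λ)
  letI : Module (base k) V := m
  haveI : IsScalarTower k Λ V := IsScalarTower.of_algebraMap_smul fun _ _ => rfl
  haveI : IsScalarTower k (base k) V := IsScalarTower.of_algebraMap_smul fun _ _ => rfl
  haveI s : SMulCommClass k Λ V := IsScalarTower.to_smulCommClass
  haveI : SMulCommClass (base k) Λ V := s
  { M := V
    finite := by
      let _ : Module (base k ⊗[k] Λ) V := TensorProduct.Algebra.module
      have : Module.Finite k V := Module.Finite.trans Λ V
      have : IsScalarTower (base k) (base k ⊗[k] Λ) V := by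
        refine IsScalarTower.of_algebraMap_smul fun r m => ?_
        rw [Algebra.TensorProduct.algebraMap_apply, TensorProduct.Algebra.smul_def]
        simp
      have : Module.Finite (base k) V := ‹Module.Finite k V›
      exact Module.Finite.of_restrictScalars_finite (base k) (base k ⊗[k] Λ) V
    free := Module.Free.of_divisionRing k V
    φ := (LinearEquiv.ofBijective (BaseChange.mk ((base k).residueMap : base k →+* k) Λ)
      ⟨BaseChange.tmul_one_injective _ residueMap_base_bijective,
        BaseChange.exists_tmul_one_eq _ (base k).residueMap_surjective⟩).symm }

namespace Lift

variable {S : CompleteLocalAlg k}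

lemma algebraMap_smul_eq (L : Lift Λ V S) (c : k) (m : L.M) :
    algebraMap k Λ c • m = algebraMap k S c • m := by
  rw [algebraMap_smul, algebraMap_smul]

/-- The reduction map `M → V`, `m ↦ φ (1 ⊗ m)`, of a lift. -/
def reduction (L : Lift Λ V S) : L.M →ₗ[Λ] V :=
  L.φ.toLinearMap.comp (BaseChange.mk (S.residueMap : S →+* k) Λ)

lemma reduction_surjective (L : Lift Λ V S) : Function.Surjective L.reduction :=
  L.φ.surjective.comp (BaseChange.exists_tmul_one_eq _ S.residueMap_surjective)

/-- This recovers the `k`-linearity of `φ`, which is only given as a `Λ`-linear map: `c` passes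
through `S` into `M`, where it acts as an element of `Λ`. -/
lemma φ_tmul (L : Lift Λ V S) (c : k) (m : L.M) :
    L.φ (BaseChange.tmul _ c m) = algebraMap k Λ c • L.reduction m := by
  rw [← map_smul, L.algebraMap_smul_eq]
  change _ = L.φ (BaseChange.tmul _ 1 _)
  rw [BaseChange.tmul_smul, residueMap_algebraMap, mul_one]

/-- Lifts have the same rank as `V`. -/
lemma finrank_eq [Module k V] [IsScalarTower k Λ V] (L : Lift Λ V S) :
    Module.finrank S L.M = Module.finrank k V := by
  have := L.free
  rw [← BaseChange.finrank_eq (S.residueMap : S →+* k) (M := L.M)]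
  let _ : Module k (BaseChange (S.residueMap : S →+* k) L.M) := BaseChange.instModule _ _
  refine LinearEquiv.finrank_eq { L.φ.toAddEquiv with map_smul' := fun c x => ?_ }
  change L.φ (c • x) = c • L.φ x
  obtain ⟨m, rfl⟩ := BaseChange.exists_tmul_one_eq _ S.residueMap_surjective x
  rw [BaseChange.smul_tmul, mul_one, L.φ_tmul, algebraMap_smul]
  rfl

/-- A map of lifts over `S` which is compatible with the reductions is an isomorphism. -/
lemma iso_of_map [Module.Finite k Λ] (L L' : Lift Λ V S) (f : L.M →ₗ[S] L'.M)
    (hf : ∀ (l : Λ) (m : L.M), f (l • m) = l • f m)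
    (hφ : ∀ m, L'.reduction (f m) = L.reduction m) : L ≈ L' := by
  let _ : Module k V := Module.compHom V (algebraMap k Λ)
  have : IsScalarTower k Λ V := IsScalarTower.of_algebraMap_smul fun _ _ => rfl
  have := L.free
  have := L'.free
  have := L.finite_over_ring
  have := L'.finite_over_ring
  -- The image of `f` covers `V` under the reduction, so Nakayama applies.
  have hsurj : Function.Surjective f := by
    rw [← LinearMap.range_eq_top]
    refine S.eq_top_of_tmul _ fun m => ?_
    obtain ⟨n, hn⟩ := L.reduction_surjective (L'.reduction m)
    exact ⟨f n, ⟨n, rfl⟩, L'.φ.injective (hn.symm.trans (hφ n).symm)⟩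
  -- Any isomorphism serves here: it turns `f` into a surjective endomorphism of a finite module,
  -- which is injective.
  have e : L'.M ≃ₗ[S] L.M := LinearEquiv.ofFinrankEq _ _ (L'.finrank_eq.trans L.finrank_eq.symm)
  have hinj : Function.Injective f := by
    have h := OrzechProperty.injective_of_surjective_endomorphism (e.toLinearMap.comp f)
      (e.surjective.comp hsurj)
    exact Function.Injective.of_comp h
  refine ⟨LinearEquiv.ofBijective f ⟨hinj, hsurj⟩, hf, fun x => ?_⟩
  obtain ⟨m, rfl⟩ := BaseChange.exists_tmul_one_eq _ S.residueMap_surjective x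
  rw [BaseChange.map_tmul]
  exact hφ m

/-- If `V` is projective, every lift of `V` is induced from every lift over `k`. -/
lemma baseChange_base_equiv [Module.Finite k Λ] [Module.Projective Λ V]
    (L₀ : Lift Λ V (base k)) (L : Lift Λ V S) (α : base k ⟶ S) : baseChange α L₀ ≈ L := by
  -- Projectivity of `V` enters here: `g` is a `Λ`-linear section of the reduction of `L`.
  obtain ⟨g, hg⟩ :=
    Module.projective_lifting_property L.reduction LinearMap.id L.reduction_surjective
  let h := g.comp L₀.reduction
  -- On both modules `k` acts through `Λ`, so `Λ`-linearity of `h` already gives semilinearity along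
  -- `α`.
  have hh (c : k) (m : L₀.M) :
      h (algebraMap k (base k) c • m) = (α.toAlgHom : base k →+* S) (algebraMap k (base k) c) •
        h m := by
    rw [← L₀.algebraMap_smul_eq, map_smul, L.algebraMap_smul_eq]
    exact congrArg (· • h m) (α.toAlgHom.commutes c).symm
  let g' : L₀.M →ₛₗ[(α.toAlgHom : base k →+* S)] L.M :=
    { toFun := h
      map_add' := map_add h
      map_smul' := hh }
  let p := BaseChange.lift (α.toAlgHom : base k →+* S) g'
  have hp (l : Λ) (x : BaseChange (α.toAlgHom : base k →+* S) L₀.M) : p (l • x) = l • p x := by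
    induction x using BaseChange.induction with
    | h0 => simp only [smul_zero, map_zero]
    | ht s m =>
      rw [BaseChange.act_tmul, BaseChange.lift_tmul, BaseChange.lift_tmul, ← smul_comm s l]
      exact congrArg (s • ·) (map_smul h l m)
    | ha x y hx hy => rw [smul_add, map_add, hx, hy, map_add, smul_add]
  -- The right-hand side is the reduction of `baseChange α L₀` unfolded; on pure tensors the claim
  -- reduces to `g` being a section.
  have hpφ (x : BaseChange (α.toAlgHom : base k →+* S) L₀.M) :
      L.reduction (p x) = L₀.φ (BaseChange.cancel Λ L₀.M (α.toAlgHom : base k →+* S)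
        (S.residueMap : S →+* k) ((base k).residueMap : base k →+* k) (residueMap_comp α)
        (BaseChange.tmul _ 1 x)) := by
    induction x using BaseChange.induction with
    | h0 => simp only [BaseChange.tmul_zero, map_zero]
    | ht s m =>
      rw [BaseChange.lift_tmul, BaseChange.cancel_tmul, one_mul, L₀.φ_tmul]
      change L.φ (BaseChange.tmul _ 1 (s • g (L₀.reduction m))) = _
      rw [BaseChange.tmul_smul, mul_one, L.φ_tmul]
      exact congrArg (_ • ·) (LinearMap.congr_fun hg _)
    | ha x y hx hy => rw [map_add, map_add, BaseChange.tmul_add, map_add, map_add, hx, hy]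
  exact iso_of_map _ _ p hp hpφ

end Lift

lemma isUniversalDeformationRing_base [Module.Finite k Λ] [Module.Finite Λ V]
    [Module.Projective Λ V] : IsUniversalDeformationRing Λ V (base k) := by
  refine ⟨Quotient.mk _ (trivialLift k Λ V), fun S D => ?_⟩
  refine ⟨S.fromBase, ?_, fun _ _ => fromBase_unique _ _⟩
  induction D using Quotient.inductionOn with
  | h L => exact Quotient.sound (Lift.baseChange_base_equiv _ L S.fromBase)

end Deformation

end ModuleDeformation

end

theorem mainTheorem7 {k Λ : Type u} [Field k] [Ring Λ] [Algebra k Λ] [Module.Finite k Λ]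
    (hΛ : ModuleDeformation.globalDimension Λ < ⊤)
    (V : Type u) [AddCommGroup V] [Module Λ V] [Module.Finite Λ V]
    (hV : ModuleDeformation.IsGorensteinProjective Λ V) :
    ∃ R : ModuleDeformation.CompleteLocalAlg k,
      ModuleDeformation.IsUniversalDeformationRing Λ V R ∧
      Nonempty (R ≅ ModuleDeformation.CompleteLocalAlg.base k) := by
  have := hV.projective hΛ
  exact ⟨ModuleDeformation.CompleteLocalAlg.base k,
    ModuleDeformation.isUniversalDeformationRing_base, ⟨Iso.refl _⟩⟩
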